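/- Let $G$ be a finite simple graph on $n$ vertices that contains no copy of $K_{r+1}$, where $r\ge 3$, let $k\ge 0$ be an integer, and suppose that $$n\ \ge\ \begin{cases}6k+26 & \text{if } r=3,\\ 6k+11 & \text{if } 4\le r\le 7,\\ 2k+9 & \text{if } r\ge 8.\end{cases}$$ Write $e(H)$ for the number of edges of a graph $H$, and $T_r(m)$ for the Turán graph, that is, the complete $r$-partite graph on $m$ vertices with parts as equal in size as possible (some parts may be empty, so that $T_r(m)=K_m$ for $m\le r$). An $n$-vertex graph is called $k$-Hamiltonian (for $0\le k\le n-3$) if, for every $0\le \ell\le k$, the removal of any $\ell$ vertices leaves a graph with a Hamiltonian cycle. If $G$ is not $k$-Hamiltonian, then $$e(G)\ \le\ e(T_r(n-1))+k+1 .$$ Moreover, for such $G$, equality holds if and only if either $G$ consists of $T_r(n-1)$ plus one vertex of degree $k+1$ (that is, $G$ has a vertex $v$ of degree $k+1$ such that $G-v\cong T_r(n-1)$), or $(k,r,n)=(0,4,11)$ and $G$ is isomorphic to the complete multipartite graph $K_{6,2,2,1}$. -/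

import Mathlib

namespace SimpleGraph

/-- A graph on `n` vertices is `k`-Hamiltonian (a notion used for `k ≤ n - 3`) if deleting any set
of at most `k` vertices leaves a Hamiltonian graph. -/
def IsKHamiltonian {V : Type*} [Fintype V] [DecidableEq V] (G : SimpleGraph V) (k : ℕ) : Prop :=
  ∀ S : Finset V, S.card ≤ k → (G.induce {v : V | v ∉ S}).IsHamiltonian

/-- `G` is a `K_{r+1}`-free graph on `n` vertices consisting of the Turán graph `T_r(n-1)` plus one
vertex `v` of degree `l + 1`: deleting `v` leaves a copy of `T_r(n-1)`. -/
def IsTuranPlusVertex {V : Type*} [Fintype V] (G : SimpleGraph V) [DecidableRel G.Adj]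
    (n r l : ℕ) : Prop :=
  Fintype.card V = n ∧ G.CliqueFree (r + 1) ∧
    ∃ v : V, G.degree v = l + 1 ∧ Nonempty (G.induce {w : V | w ≠ v} ≃g turanGraph (n - 1) r)

/-- The complete multipartite graph `K_{6,2,2,1}`. -/
def K6221 : SimpleGraph (Σ i : Fin 4, Fin (![6, 2, 2, 1] i)) :=
  completeMultipartiteGraph fun i : Fin 4 => Fin (![6, 2, 2, 1] i)

end SimpleGraph

/-!
If deleting a set `S` of at most `k` vertices leaves a non-Hamiltonian graph, Chvátal's degree
sequence theorem (a consequence of the Bondy–Chvátal closure lemma) provides some `i < (n - #S) / 2`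
and a set `A` of `i` vertices, each of degree at most `i + #S` in `G`. Deleting `A` and applying
Turán's theorem to the rest gives `e(G) ≤ t_r(n - i) + i * (i + #S)`. For `i = 1` this is the
asserted bound, and equality forces the Turán graph plus one vertex.

For `i ≥ 2` the estimates `(r - 1) * n ^ 2 - r ^ 2 / 4 ≤ 2 * r * t_r(n) ≤ (r - 1) * n ^ 2` show that
the right side is strictly smaller than `t_r(n - 1) + #S + 1`, with two provisos. For `r = 3` one
has to delete a suitable subset of `A` instead of `A` itself. For `r = 4`, `n = 11`, `#S = 0`,
`i = 5` both sides equal `38`; in this case Chvátal's theorem also yields six vertices of degree at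
most `5`. If each of them missed one of the other five vertices, there would be fewer than `38`
edges. So one of them is joined to all five, which therefore span no `K_4`, hence at most `8` edges,
and `38` is reached only if the six vertices are independent, of degree `5`, and the rest is
`T_3(5) = K_{2,2,1}`.
-/

open SimpleGraph Finset

section Chvatal

variable {V : Type*} [Fintype V] {G H : SimpleGraph V} {u v : V}

section Hamiltonian

variable [DecidableEq V]

theorem isHamiltonian_top (hV : 3 ≤ Fintype.card V) : (⊤ : SimpleGraph V).IsHamiltonian := by
  have e : Fin (Fintype.card V) ≃ V := (Fintype.equivFin V).symm
  have hcycle : cycleGraph (Fintype.card V) ⊑ (⊤ : SimpleGraph V) :=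
    ⟨⟨⟨e, fun h => e.injective.ne h.ne⟩, e.injective⟩⟩
  obtain ⟨v, p, hp, hlength⟩ := (cycleGraph_isContained_iff hV).1 hcycle
  exact fun _ => ⟨v, p, Walk.isHamiltonianCycle_iff_isCycle_and_length_eq.2 ⟨hp, hlength⟩⟩

theorem isHamiltonian_of_hamiltonianPath_of_adj (hV : 3 ≤ Fintype.card V) {p : G.Walk u v}
    (hp : p.IsHamiltonian) (hvu : G.Adj v u) : G.IsHamiltonian := by
  have hlength : (Walk.cons hvu p).length = Fintype.card V := by
    rw [Walk.length_cons, hp.length_eq]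
    omega
  have hcycle : (Walk.cons hvu p).IsCycle :=
    Walk.isCycle_iff_isPath_tail_and_le_length.2 ⟨by simpa using hp.isPath, hlength ▸ hV⟩
  exact fun _ => ⟨v, _, Walk.isHamiltonianCycle_iff_isCycle_and_length_eq.2 ⟨hcycle, hlength⟩⟩

theorem isHamiltonian_of_hamiltonianPath_of_crossing (hV : 3 ≤ Fintype.card V) {p : G.Walk u v}
    (hp : p.IsHamiltonian) {i : ℕ} (hi : i < p.length) (hu : G.Adj u (p.getVert (i + 1)))
    (hv : G.Adj v (p.getVert i)) : G.IsHamiltonian := by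
  -- Follow `p` backwards from `p i` to `u`, jump to `p (i + 1)`, and continue to `v`.
  refine isHamiltonian_of_hamiltonianPath_of_adj hV
    (p := (p.take i).reverse.append (.cons hu (p.drop (i + 1)))) (fun w => ?_) hv
  have hsplit : p.support = p.support.take (i + 1) ++ p.support.drop (i + 1) :=
    (List.take_append_drop _ _).symm
  have hcount := hp w
  rw [hsplit, List.count_append] at hcount
  rw [Walk.support_append, Walk.support_cons, List.tail_cons, Walk.support_reverse,
    Walk.support_take, Walk.drop_support_eq_support_drop_min, min_eq_left hi, List.count_append,
    List.count_reverse, hcount]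

theorem isHamiltonian_of_hamiltonianPath_of_card_le_degree_add_degree [DecidableRel G.Adj]
    (hV : 3 ≤ Fintype.card V) {p : G.Walk u v} (hp : p.IsHamiltonian)
    (hdeg : Fintype.card V ≤ G.degree u + G.degree v) : G.IsHamiltonian := by
  have hlength := hp.length_eq
  let A := {i ∈ range p.length | G.Adj u (p.getVert (i + 1))}
  let B := {i ∈ range p.length | G.Adj v (p.getVert i)}
  have hA : G.degree u ≤ #A := by
    refine (card_le_card fun w hw => ?_).trans (card_image_le (f := fun i => p.getVert (i + 1)))
    obtain ⟨i, rfl, hi⟩ := Walk.mem_support_iff_exists_getVert.1 (hp.mem_support w)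
    rw [mem_neighborFinset] at hw
    obtain _ | i := i
    · exact absurd hw (by simp)
    · exact mem_image_of_mem _ (mem_filter.2 ⟨mem_range.2 hi, hw⟩)
  have hB : G.degree v ≤ #B := by
    refine (card_le_card fun w hw => ?_).trans (card_image_le (f := p.getVert))
    obtain ⟨i, rfl, hi⟩ := Walk.mem_support_iff_exists_getVert.1 (hp.mem_support w)
    rw [mem_neighborFinset] at hw
    obtain rfl | hi := hi.eq_or_lt
    · exact absurd hw (by simp)
    · exact mem_image_of_mem _ (mem_filter.2 ⟨mem_range.2 hi, hw⟩)
  obtain ⟨i, hi⟩ : (A ∩ B).Nonempty :=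
    inter_nonempty_of_card_lt_card_add_card (filter_subset _ _) (filter_subset _ _)
      (by rw [card_range]; omega)
  simp only [A, B, mem_inter, mem_filter, mem_range] at hi
  exact isHamiltonian_of_hamiltonianPath_of_crossing hV hp hi.1.1 hi.1.2 hi.2.2

theorem exists_hamiltonianPath_of_isHamiltonian_sup_edge [Nontrivial V]
    (hG : ¬ G.IsHamiltonian) (hGuv : (G ⊔ edge u v).IsHamiltonian) :
    ∃ p : G.Walk v u, p.IsHamiltonian := by
  obtain ⟨p, hp⟩ := hGuv.exists_isHamiltonianCycle u
  have hedges : ∀ e ∈ (G ⊔ edge u v).edgeSet, e ≠ s(u, v) → e ∈ G.edgeSet := by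
    intro e he hne
    rw [edgeSet_sup] at he
    exact he.resolve_right fun he => hne (edgeSet_edge_subset he)
  have huv : s(u, v) ∈ p.edges := by
    by_contra huv
    have hle := fun e he => hedges e (p.edges_subset_edgeSet he) (ne_of_mem_of_not_mem he huv)
    refine hG fun _ => ⟨u, p.transfer G hle, ?_⟩
    rw [Walk.isHamiltonianCycle_iff_isCycle_and_length_eq, Walk.length_transfer]
    exact ⟨hp.isCycle.transfer hle, hp.length_eq⟩
  wlog hsnd : p.snd = v generalizing p
  · refine this p.reverse ?_ (by simpa using huv) ?_
    · rw [Walk.isHamiltonianCycle_iff_isCycle_and_length_eq, Walk.length_reverse]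
      exact ⟨hp.isCycle.reverse, hp.length_eq⟩
    · have hv : v ∈ p.toSubgraph.neighborSet u := Walk.adj_toSubgraph_iff_mem_edges.2 huv
      rw [hp.isCycle.neighborSet_toSubgraph_endpoint] at hv
      rw [Walk.snd_reverse]
      exact (hv.resolve_left fun h => hsnd h.symm).symm
  obtain ⟨w, huw, q, rfl⟩ := Walk.not_nil_iff.1 hp.isCycle.not_nil
  obtain rfl : v = w := by simpa using hsnd.symm
  have hq := ((Walk.cons_isCycle_iff _ _).1 hp.isCycle).2
  refine ⟨q.transfer G fun e he => hedges e (q.edges_subset_edgeSet he)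
    (ne_of_mem_of_not_mem he hq), fun w => ?_⟩
  rw [Walk.support_transfer]
  simpa using hp.isHamiltonian_tail w

theorem isHamiltonian_of_isHamiltonian_sup_edge [DecidableRel G.Adj] (hV : 3 ≤ Fintype.card V)
    (hGuv : (G ⊔ edge u v).IsHamiltonian) (hdeg : Fintype.card V ≤ G.degree u + G.degree v) :
    G.IsHamiltonian := by
  have : Nontrivial V := Fintype.one_lt_card_iff_nontrivial.1 (by omega)
  by_contra hG
  obtain ⟨p, hp⟩ := exists_hamiltonianPath_of_isHamiltonian_sup_edge hG hGuv
  exact hG (isHamiltonian_of_hamiltonianPath_of_card_le_degree_add_degree hV hp (by omega))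

end Hamiltonian

section DegreeSequence

variable [DecidableRel G.Adj]

/-- A level `i` at which Chvátal's degree sequence condition for Hamiltonicity fails. If
`d₁ ≤ ⋯ ≤ dₙ` are the degrees of `G`, it says that `dᵢ ≤ i < n / 2` and `dₙ₋ᵢ < n - i`. -/
structure IsChvatalObstruction (G : SimpleGraph V) [DecidableRel G.Adj] (i : ℕ) : Prop where
  pos : 1 ≤ i
  two_mul_lt : 2 * i < Fintype.card V
  le_card_degree_le : i ≤ #{v | G.degree v ≤ i}
  le_card_degree_lt : Fintype.card V - i ≤ #{v | G.degree v < Fintype.card V - i}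

theorem IsChvatalObstruction.anti [DecidableRel H.Adj] {i : ℕ} (hGH : G ≤ H)
    (h : IsChvatalObstruction H i) : IsChvatalObstruction G i where
  pos := h.pos
  two_mul_lt := h.two_mul_lt
  le_card_degree_le := h.le_card_degree_le.trans <| card_le_card <|
    monotone_filter_right _ fun _ _ hv => (degree_le_of_le hGH).trans hv
  le_card_degree_lt := h.le_card_degree_lt.trans <| card_le_card <|
    monotone_filter_right _ fun _ _ hv => (degree_le_of_le hGH).trans_lt hv

theorem isChvatalObstruction_one_of_degree_eq_zero (hV : 3 ≤ Fintype.card V)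
    (hv : G.degree v = 0) : IsChvatalObstruction G 1 where
  pos := le_rfl
  two_mul_lt := by omega
  le_card_degree_le := card_pos.2 ⟨v, by simp [hv]⟩
  le_card_degree_lt := by
    have hlt : ∀ w, G.degree w < Fintype.card V - 1 := by
      intro w
      obtain rfl | hwv := eq_or_ne w v
      · omega
      · refine (G.degree_lt_card_sub_one w).2 fun hw => ?_
        exact ((G.degree_pos_iff_exists_adj v).2 ⟨w, (hw hwv).symm⟩).ne' hv
    rw [filter_true_of_mem fun w _ => hlt w]
    exact Nat.sub_le _ _

theorem exists_isChvatalObstruction_of_degree_add_degree_lt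
    (hV : 3 ≤ Fintype.card V) (hG : G ≠ ⊤)
    (hdeg : ∀ u v, u ≠ v → ¬ G.Adj u v → G.degree u + G.degree v < Fintype.card V) :
    ∃ i, IsChvatalObstruction G i := by
  classical
  -- The obstruction is the smaller degree in a non-adjacent pair with the largest degree sum.
  obtain ⟨a, b, hab, hadj⟩ := ne_top_iff_exists_not_adj.1 hG
  obtain ⟨⟨u, v⟩, huv, hmax⟩ :=
    exists_max_image {p : V × V | p.1 ≠ p.2 ∧ ¬ G.Adj p.1 p.2}
    (fun p => G.degree p.1 + G.degree p.2) ⟨(a, b), by simp [hab, hadj]⟩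
  simp only [mem_filter, mem_univ, true_and, and_imp, Prod.forall] at huv hmax
  wlog hle : G.degree u ≤ G.degree v generalizing u v
  · exact this v u ⟨huv.1.symm, fun h => huv.2 h.symm⟩ (by simpa only [add_comm] using hmax)
      (by omega)
  obtain hu | hu := (G.degree u).eq_zero_or_pos
  · exact ⟨1, isChvatalObstruction_one_of_degree_eq_zero hV hu⟩
  have hlt := hdeg u v huv.1 huv.2
  refine ⟨G.degree u, hu, by omega, ?_, ?_⟩
  · calc G.degree u ≤ #(insert v (G.neighborFinset v))ᶜ := by
          rw [card_compl, card_insert_of_notMem (by simp), card_neighborFinset_eq_degree]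
          omega
      _ ≤ _ := card_le_card fun w hw => by
          simp only [mem_compl, mem_insert, mem_neighborFinset, not_or] at hw
          have := hmax w v hw.1 fun h => hw.2 h.symm
          exact mem_filter.2 ⟨mem_univ w, by omega⟩
  · calc Fintype.card V - G.degree u ≤ #(G.neighborFinset u)ᶜ := by
          rw [card_compl, card_neighborFinset_eq_degree]
      _ ≤ _ := card_le_card fun w hw => by
          rw [mem_compl, mem_neighborFinset] at hw
          refine mem_filter.2 ⟨mem_univ w, ?_⟩
          obtain rfl | hwu := eq_or_ne w u
          · omega
          · have := hmax u w hwu.symm hw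
            omega

end DegreeSequence

theorem exists_isChvatalObstruction_of_not_isHamiltonian [DecidableEq V] [DecidableRel G.Adj]
    (hV : 3 ≤ Fintype.card V) (hG : ¬ G.IsHamiltonian) : ∃ i, IsChvatalObstruction G i := by
  classical
  obtain ⟨H, hGH, hH⟩ :=
    Finite.exists_le_maximal (p := fun H : SimpleGraph V => ¬ H.IsHamiltonian) hG
  suffices h : ∃ i, IsChvatalObstruction H i from h.imp fun i hi => hi.anti hGH
  refine exists_isChvatalObstruction_of_degree_add_degree_lt hV (fun h => hH.prop ?_)
    fun u v hne huv => ?_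
  · exact h ▸ isHamiltonian_top hV
  · by_contra! hdeg
    refine hH.prop (isHamiltonian_of_isHamiltonian_sup_edge hV ?_ hdeg)
    by_contra hsup
    exact hH.not_prop_of_gt (H.lt_sup_edge _ _ hne huv) hsup

end Chvatal

section EdgeCount

variable {V : Type*} [Fintype V] {G : SimpleGraph V} [DecidableRel G.Adj]

theorem two_mul_card_edgeFinset_induce (p : V → Prop) [DecidablePred p]
    [Fintype (G.induce {v | p v}).edgeSet] :
    2 * #(G.induce {v | p v}).edgeFinset = ∑ v with p v, #{w | p w ∧ G.Adj v w} := by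
  have hdeg (x : {v | p v}) : (G.induce {v | p v}).degree x = #{w | p w ∧ G.Adj x w} := by
    rw [← card_neighborFinset_eq_degree, neighborFinset_eq_filter, ← card_map (.subtype _)]
    congr 1
    ext w
    simp [and_comm]
  calc 2 * #(G.induce {v | p v}).edgeFinset = ∑ x, (G.induce {v | p v}).degree x := by
        rw [sum_degrees_eq_twice_card_edges]
        congr!
    _ = ∑ v with p v, #{w | p w ∧ G.Adj v w} := by
        simp only [hdeg]
        exact (sum_subtype _ (by simp) fun v => #{w | p w ∧ G.Adj v w}).symm

variable [DecidableEq V]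

theorem card_notMem (A : Finset V) : Fintype.card {v | v ∉ A} = Fintype.card V - #A := by
  rw [← card_compl, ← Fintype.card_coe]
  exact Fintype.card_congr (Equiv.subtypeEquivRight fun v => by simp)

theorem degree_le_degree_induce_notMem_add_card (S : Finset V) (v : {v | v ∉ S}) :
    G.degree v ≤ (G.induce {v | v ∉ S}).degree v + #S := by
  have hsub : G.neighborFinset v ⊆
      ((G.induce {v | v ∉ S}).neighborFinset v).map (.subtype _) ∪ S := by
    intro w hw
    rw [mem_neighborFinset] at hw
    by_cases hS : w ∈ S
    · exact mem_union_right _ hS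
    · exact mem_union_left _ (mem_map.2 ⟨⟨w, hS⟩, (mem_neighborFinset _ _ _).2 hw, rfl⟩)
  calc G.degree v ≤ _ := card_le_card hsub
    _ ≤ _ := card_union_le _ _
    _ = _ := by rw [card_map, card_neighborFinset_eq_degree]

theorem IsChvatalObstruction.le_card_degree_le_add {S : Finset V} {i : ℕ}
    (h : IsChvatalObstruction (G.induce {v | v ∉ S}) i) : i ≤ #{v | G.degree v ≤ i + #S} := by
  refine h.le_card_degree_le.trans ?_
  rw [← card_map (.subtype _)]
  refine card_le_card fun v hv => ?_
  obtain ⟨x, hx, rfl⟩ := mem_map.1 hv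
  refine mem_filter.2 ⟨mem_univ _, (degree_le_degree_induce_notMem_add_card S x).trans ?_⟩
  exact Nat.add_le_add_right (mem_filter.1 hx).2 _

theorem IsChvatalObstruction.le_card_degree_lt_sub {S : Finset V} {i : ℕ}
    (h : IsChvatalObstruction (G.induce {v | v ∉ S}) i) :
    Fintype.card V - #S - i ≤ #{v | G.degree v < Fintype.card V - i} := by
  have hlow := h.le_card_degree_lt
  rw [card_notMem] at hlow
  refine hlow.trans ?_
  rw [← card_map (.subtype _)]
  refine card_le_card fun v hv => ?_
  obtain ⟨x, hx, rfl⟩ := mem_map.1 hv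
  refine mem_filter.2 ⟨mem_univ _, (degree_le_degree_induce_notMem_add_card S x).trans_lt ?_⟩
  have hdeg := (mem_filter.1 hx).2
  have hi := h.two_mul_lt
  rw [card_notMem] at hi
  omega

theorem degree_eq_card_filter_add_card_filter (A : Finset V) (v : V) :
    G.degree v = #{w | w ∈ A ∧ G.Adj v w} + #{w | w ∉ A ∧ G.Adj v w} := by
  rw [← card_neighborFinset_eq_degree, neighborFinset_eq_filter,
    ← card_filter_add_card_filter_not (· ∈ A), filter_filter, filter_filter]
  simp only [and_comm]

theorem sum_degree_eq_two_mul_card_edgeFinset_induce_add (A : Finset V) :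
    ∑ v ∈ A, G.degree v = 2 * #(G.induce {v | v ∈ A}).edgeFinset +
      ∑ v ∈ A, #{w | w ∉ A ∧ G.Adj v w} := by
  rw [two_mul_card_edgeFinset_induce, filter_univ_mem, ← sum_add_distrib]
  exact sum_congr rfl fun v _ => degree_eq_card_filter_add_card_filter A v

theorem card_edgeFinset_eq_card_edgeFinset_induce_add (A : Finset V) :
    #G.edgeFinset = #(G.induce {v | v ∈ A}).edgeFinset + #(G.induce {v | v ∉ A}).edgeFinset +
      ∑ v ∈ A, #{w | w ∉ A ∧ G.Adj v w} := by
  have hin := sum_degree_eq_two_mul_card_edgeFinset_induce_add (G := G) A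
  have hout := two_mul_card_edgeFinset_induce (G := G) (· ∉ A)
  have htotal := G.sum_degrees_eq_twice_card_edges
  have hcross : ∑ v with v ∉ A, #{w | w ∈ A ∧ G.Adj v w} =
      ∑ v ∈ A, #{w | w ∉ A ∧ G.Adj v w} := by
    have hdouble :=
      sum_card_bipartiteAbove_eq_sum_card_bipartiteBelow (s := {v | v ∉ A}) (t := A) G.Adj
    simpa only [bipartiteAbove, bipartiteBelow, ← filter_filter, filter_univ_mem, G.adj_comm]
      using hdouble
  rw [← sum_filter_add_sum_filter_not univ (· ∈ A), filter_univ_mem, hin] at htotal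
  simp only [degree_eq_card_filter_add_card_filter A, sum_add_distrib, hcross, ← hout] at htotal
  omega

theorem card_edgeFinset_eq_card_edgeFinset_induce_ne_add_degree (v : V) :
    #G.edgeFinset = #(G.induce {w | w ≠ v}).edgeFinset + G.degree v := by
  have hle := card_le_card (G.incidenceFinset_subset v)
  rw [card_incidenceFinset_eq_degree] at hle
  have h := card_edgeFinset_deleteIncidenceSet G v
  rw [← card_edgeFinset_induce_compl_singleton] at h
  refine (Nat.sub_eq_iff_eq_add hle).1 (h.symm.trans ?_)
  congr!

end EdgeCount

section Turan

section CliqueFree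

variable {V : Type*} [Fintype V] {G : SimpleGraph V} {n r : ℕ}

theorem card_edgeFinset_le_turanGraph [Fintype G.edgeSet] (hG : G.CliqueFree (r + 1))
    (hV : Fintype.card V = n) : #G.edgeFinset ≤ #(turanGraph n r).edgeFinset := by
  classical
  rw [card_edgeFinset_turanGraph, ← hV]
  convert hG.card_edgeFinset_le

theorem nonempty_iso_turanGraph_of_le_card_edgeFinset [Fintype G.edgeSet]
    (hG : G.CliqueFree (r + 1)) (hV : Fintype.card V = n)
    (hle : #(turanGraph n r).edgeFinset ≤ #G.edgeFinset) : Nonempty (G ≃g turanGraph n r) := by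
  classical
  subst hV
  refine IsTuranMaximal.nonempty_iso_turanGraph ⟨hG, fun H _ hH => ?_⟩
  refine ((card_edgeFinset_le_turanGraph hH rfl).trans hle).trans (le_of_eq ?_)
  congr!

theorem card_edgeFinset_le_turanGraph_add_of_degree_le [DecidableRel G.Adj]
    (hG : G.CliqueFree (r + 1)) {A : Finset V} {d : ℕ} (hA : ∀ v ∈ A, G.degree v ≤ d) :
    #G.edgeFinset ≤ #(turanGraph (Fintype.card V - #A) r).edgeFinset + #A * d := by
  classical
  have hcard := card_edgeFinset_eq_card_edgeFinset_induce_add (G := G) A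
  have hsum := sum_degree_eq_two_mul_card_edgeFinset_induce_add (G := G) A
  have hout := card_edgeFinset_le_turanGraph
    (hG.comap ⟨(Embedding.induce {v | v ∉ A}).toCopy⟩) (card_notMem A)
  have hdeg := sum_le_card_nsmul _ _ _ hA
  rw [smul_eq_mul] at hdeg
  omega

end CliqueFree

theorem card_edgeFinset_turanGraph_of_le {n r : ℕ} (h : n ≤ r) :
    #(turanGraph n r).edgeFinset = n.choose 2 := by
  have htop : turanGraph n r = ⊤ := turanGraph_eq_top.2 (.inr h)
  have hcard := card_edgeFinset_top_eq_card_choose_two (V := Fin n)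
  rw [Fintype.card_fin] at hcard
  rw [← hcard]
  congr!

theorem two_mul_choose_two_add (n : ℕ) : 2 * n.choose 2 + n = n ^ 2 := by
  rw [Nat.choose_two_right, Nat.mul_div_cancel' n.even_mul_pred_self.two_dvd]
  cases n <;> grind

theorem card_edgeFinset_turanGraph_mul_add {r s : ℕ} (hs : s ≤ r) (q : ℕ) :
    #(turanGraph (q * r + s) r).edgeFinset =
      r.choose 2 * q ^ 2 + (r - 1) * q * s + s.choose 2 := by
  induction q with
  | zero =>
    rw [card_edgeFinset_turanGraph_of_le (by omega)]
    simp
  | succ q ih =>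
    obtain rfl | hr := r.eq_zero_or_pos
    · simp_all
    have hchoose := two_mul_choose_two_add r
    rw [show (q + 1) * r + s = q * r + s + r by ring, card_edgeFinset_turanGraph_add, ih]
    zify [show 1 ≤ r from hr] at *
    linear_combination -q * hchoose

theorem two_mul_mul_card_edgeFinset_turanGraph_add {n r : ℕ} (hr : 0 < r) :
    2 * r * #(turanGraph n r).edgeFinset + n % r * (r - n % r) = (r - 1) * n ^ 2 := by
  have hmod := (Nat.mod_lt n hr).le
  have hcard := card_edgeFinset_turanGraph_mul_add hmod (n / r)
  have hdiv := Nat.div_add_mod' n r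
  have hs := two_mul_choose_two_add (n % r)
  have hr2 := two_mul_choose_two_add r
  rw [hdiv] at hcard
  rw [hcard]
  generalize n % r = s at *
  generalize n / r = q at *
  subst hdiv
  zify [hmod, show 1 ≤ r from hr] at *
  linear_combination (r : ℤ) * hs + (r : ℤ) * q ^ 2 * hr2

theorem card_edgeFinset_turanGraph_succ {r : ℕ} (hr : 0 < r) (m : ℕ) :
    #(turanGraph (m + 1) r).edgeFinset = #(turanGraph m r).edgeFinset + (m - m / r) := by
  have hmod := Nat.mod_lt m hr
  have hm := card_edgeFinset_turanGraph_mul_add hmod.le (m / r)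
  have hm1 := card_edgeFinset_turanGraph_mul_add (Nat.succ_le_of_lt hmod) (m / r)
  have hdiv := Nat.div_add_mod' m r
  rw [Nat.succ_eq_add_one, ← add_assoc, hdiv] at hm1
  rw [hdiv] at hm
  rw [hm1, hm, Nat.choose_succ_succ' _ 1, Nat.choose_one_right]
  have := Nat.div_le_self m r
  zify [this, show 1 ≤ r from hr] at hdiv ⊢
  linear_combination hdiv

theorem four_mul_sub_one_mul_sq_le_card_edgeFinset_turanGraph {n r : ℕ} (hr : 0 < r) :
    4 * ((r - 1) * n ^ 2) ≤ 8 * (r * #(turanGraph n r).edgeFinset) + r ^ 2 := by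
  have hcard := two_mul_mul_card_edgeFinset_turanGraph_add (n := n) hr
  have hmod := four_mul_le_sq_add (n % r) (r - n % r)
  rw [Nat.add_sub_cancel' (Nat.mod_lt n hr).le] at hmod
  linarith

-- The growth of `t_r` from `m` to `n` increases with `r`, so only `r = 4, 5, 8` need estimates.
theorem card_edgeFinset_turanGraph_add_le_add {m n r s : ℕ} (hs : 0 < s) (hsr : s ≤ r)
    (hmn : m ≤ n) : #(turanGraph n s).edgeFinset + #(turanGraph m r).edgeFinset ≤
      #(turanGraph n r).edgeFinset + #(turanGraph m s).edgeFinset := by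
  induction n, hmn using Nat.le_induction with
  | base => rw [add_comm]
  | succ n _ ih =>
    rw [card_edgeFinset_turanGraph_succ hs, card_edgeFinset_turanGraph_succ (hs.trans_le hsr)]
    have : n / r ≤ n / s := Nat.div_le_div_left hsr hs
    omega

theorem le_card_edgeFinset_turanGraph_sub {n r i k : ℕ} (hr : 0 < r) (hi : 1 ≤ i) (hin : i ≤ n) :
    4 * ((i - 1) * ((r - 1) * (2 * n - i - 1) - 2 * r * (i + 1 + k))) - r ^ 2 ≤
      8 * r * ((#(turanGraph (n - 1) r).edgeFinset + (k + 1)) -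
        (#(turanGraph (n - i) r).edgeFinset + i * (i + k)) : ℤ) := by
  have hlower := four_mul_sub_one_mul_sq_le_card_edgeFinset_turanGraph (n := n - 1) hr
  have hupper := mul_card_edgeFinset_turanGraph_le (n := n - i) (r := r)
  zify [show 1 ≤ r from hr, hin, hi.trans hin] at hlower hupper
  linarith

theorem turanGraph_four_add_lt_or {n i k : ℕ} (hi : 2 ≤ i) (hin : 2 * i + k < n)
    (hn : 6 * k + 11 ≤ n) :
    #(turanGraph (n - i) 4).edgeFinset + i * (i + k) <
        #(turanGraph (n - 1) 4).edgeFinset + (k + 1) ∨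
      k = 0 ∧ n = 11 ∧ i = 5 := by
  have hgap := le_card_edgeFinset_turanGraph_sub (n := n) (r := 4) (i := i) (k := k)
    (by norm_num) (by omega) (by omega)
  push_cast at hgap
  obtain ⟨x, hx⟩ : ∃ x : ℤ, x = 6 * n - 11 * i - 11 - 8 * k := ⟨_, rfl⟩
  by_contra! hle
  have hx4 : (i - 1) * x ≤ 4 := by
    zify at hle
    rw [hx]
    linarith
  obtain hi6 | hi6 := lt_or_ge i 6
  · interval_cases i <;> omega
  · have hx1 : 1 ≤ x := by omega
    nlinarith

theorem turanGraph_eight_add_lt {n i k : ℕ} (hi : 2 ≤ i) (hin : 2 * i + k < n)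
    (hn : 2 * k + 9 ≤ n) :
    #(turanGraph (n - i) 8).edgeFinset + i * (i + k) <
      #(turanGraph (n - 1) 8).edgeFinset + (k + 1) := by
  have hgap := le_card_edgeFinset_turanGraph_sub (n := n) (r := 8) (i := i) (k := k)
    (by norm_num) (by omega) (by omega)
  push_cast at hgap
  have hx : 16 < (i - 1) * (14 * n - 23 * i - 23 - 16 * k : ℤ) := by
    obtain rfl | hi3 := hi.eq_or_lt
    · omega
    · nlinarith
  zify
  linarith

theorem turanGraph_add_lt_or_of_four_le {n r i k : ℕ} (hr : 4 ≤ r) (hi : 2 ≤ i)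
    (hin : 2 * i + k < n) (hn : 6 * k + 11 ≤ n) :
    #(turanGraph (n - i) r).edgeFinset + i * (i + k) <
        #(turanGraph (n - 1) r).edgeFinset + (k + 1) ∨
      k = 0 ∧ r = 4 ∧ n = 11 ∧ i = 5 := by
  obtain hlt | ⟨rfl, rfl, rfl⟩ := turanGraph_four_add_lt_or hi hin hn
  · have := card_edgeFinset_turanGraph_add_le_add (by norm_num) hr (show n - i ≤ n - 1 by omega)
    omega
  · obtain rfl | hr5 : r = 4 ∨ 5 ≤ r := by omega
    · exact .inr ⟨rfl, rfl, rfl, rfl⟩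
    · have := card_edgeFinset_turanGraph_add_le_add (by norm_num) hr5 (show 6 ≤ 10 by norm_num)
      have h10 : #(turanGraph 10 5).edgeFinset = 40 := by decide
      have h6 : #(turanGraph 6 5).edgeFinset = 14 := by decide
      left
      change #(turanGraph 6 r).edgeFinset + 5 * (5 + 0) < #(turanGraph 10 r).edgeFinset + (0 + 1)
      omega

theorem turanGraph_add_lt_of_eight_le {n r i k : ℕ} (hr : 8 ≤ r) (hi : 2 ≤ i)
    (hin : 2 * i + k < n) (hn : 2 * k + 9 ≤ n) :
    #(turanGraph (n - i) r).edgeFinset + i * (i + k) <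
      #(turanGraph (n - 1) r).edgeFinset + (k + 1) := by
  have hlt := turanGraph_eight_add_lt hi hin hn
  have := card_edgeFinset_turanGraph_add_le_add (by norm_num) hr (show n - i ≤ n - 1 by omega)
  omega

-- Deleting all `a` vertices of low degree is too wasteful when `a` is close to `n / 2`. Deleting
-- only `b` of them gains `b * (s - b)` up to constants, where `s = 2 * n - 3 * a - 3 * k`; for
-- large `a` this is maximal at `b = s / 2 ≤ a`.
theorem exists_le_three_mul_add_sq_le {n a k : ℕ} (ha : 2 ≤ a) (han : 2 * a + k < n)
    (hn : 6 * k + 26 ≤ n) :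
    ∃ b ≤ a, 3 * (b * (a + k)) + (n - b) ^ 2 + 2 ≤ (n - 1) ^ 2 + 3 * (k + 1) := by
  suffices h : ∃ b ≤ a, (2 * n - 3 * k - 2 : ℤ) ≤ b * (2 * n - 3 * a - 3 * k - b) by
    refine h.imp fun b ⟨hba, hb⟩ => ⟨hba, ?_⟩
    zify [show b ≤ n by omega, show 1 ≤ n by omega]
    linarith only [hb]
  obtain hlt | hge := lt_or_ge (5 * a + 3 * k) (2 * n)
  · refine ⟨a, le_rfl, ?_⟩
    obtain ha4 | ha4 := lt_or_ge a 4
    · interval_cases a <;> push_cast <;> omega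
    · zify at *
      nlinarith
  · obtain ⟨s, hs⟩ := Nat.exists_eq_add_of_le (show 3 * a + 3 * k ≤ 2 * n by omega)
    obtain ⟨t, rfl⟩ := Nat.exists_eq_add_of_le hn
    obtain ⟨b, hb⟩ := s.even_or_odd'
    refine ⟨b, by omega, ?_⟩
    have hfloor : (s : ℤ) ^ 2 ≤ 4 * (b * (s - b)) + 1 := by
      obtain rfl | rfl := hb <;> push_cast <;> linarith
    have hs2 : 3 * k + 29 + t ≤ 2 * s := by omega
    have hsq := Nat.pow_le_pow_left hs2 2
    zify at hs hsq ⊢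
    rw [show (2 * (6 * k + 26 + t) - 3 * a - 3 * k - b : ℤ) = s - b by linarith]
    nlinarith

theorem card_edgeFinset_lt_of_cliqueFree_four {V : Type*} [Fintype V] {G : SimpleGraph V}
    [DecidableRel G.Adj] (hG : G.CliqueFree 4) {A : Finset V} {k : ℕ}
    (hA : 2 ≤ #A) (hdeg : ∀ v ∈ A, G.degree v ≤ #A + k) (hAV : 2 * #A + k < Fintype.card V)
    (hV : 6 * k + 26 ≤ Fintype.card V) :
    #G.edgeFinset < #(turanGraph (Fintype.card V - 1) 3).edgeFinset + (k + 1) := by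
  obtain ⟨b, hb, hle⟩ := exists_le_three_mul_add_sq_le hA hAV hV
  obtain ⟨B, hBA, rfl⟩ := exists_subset_card_eq hb
  have hcard :=
    card_edgeFinset_le_turanGraph_add_of_degree_le (r := 3) hG fun v hv => hdeg v (hBA hv)
  have hlower := four_mul_sub_one_mul_sq_le_card_edgeFinset_turanGraph (n := Fintype.card V - 1)
    (r := 3) (by norm_num)
  have hupper := mul_card_edgeFinset_turanGraph_le (n := Fintype.card V - #B) (r := 3)
  norm_num at hlower hupper
  linarith

end Turan

section K6221

variable {V : Type*} {G : SimpleGraph V}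

theorem cliqueFree_induce_of_forall_adj {n : ℕ} (hG : G.CliqueFree (n + 1)) {s : Set V} {x : V}
    (hx : ∀ w ∈ s, G.Adj x w) : (G.induce s).CliqueFree n := by
  classical
  rw [cliqueFree_induce_iff]
  exact fun t hts ht => hG _ (ht.insert fun w hw => hx w (hts hw))

theorem nonempty_iso_completeMultipartiteGraph [Fintype V] {ι : Type*} [DecidableEq ι]
    (m : ι → ℕ) (f : V → ι) (hadj : ∀ x y, G.Adj x y ↔ f x ≠ f y)
    (hcard : ∀ i, #{x | f x = i} = m i) :
    Nonempty (G ≃g completeMultipartiteGraph fun i => Fin (m i)) := by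
  have e (i : ι) : {x // f x = i} ≃ Fin (m i) :=
    Fintype.equivFinOfCardEq (by rw [Fintype.card_subtype, hcard])
  exact ⟨(Equiv.sigmaFiberEquiv f).symm.trans (Equiv.sigmaCongrRight e), (hadj _ _).symm⟩

instance decidableRelAdjK6221 : DecidableRel K6221.Adj :=
  fun x y => inferInstanceAs (Decidable (x.1 ≠ y.1))

theorem card_edgeFinset_K6221 : #K6221.edgeFinset = 38 := by decide

theorem nonempty_iso_K6221_of_iso_turanGraph [Finite V] {I : Finset V} (hI : #I = 6)
    (hind : ∀ x ∈ I, ∀ y ∈ I, ¬ G.Adj x y) (hjoin : ∀ x ∈ I, ∀ y ∉ I, G.Adj x y)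
    (φ : G.induce {v | v ∉ I} ≃g turanGraph 5 3) : Nonempty (G ≃g K6221) := by
  classical
  have := Fintype.ofFinite V
  let g : Fin 5 → Fin 4 := ![1, 2, 3, 1, 2]
  have hg0 : ∀ s, g s ≠ 0 := by decide
  have hg : ∀ s t, g s ≠ g t ↔ (turanGraph 5 3).Adj s t := by decide
  have hg_card : ∀ i, (if i = 0 then 6 else 0) + #{s | g s = i} =
      (![6, 2, 2, 1] : Fin 4 → ℕ) i := by decide
  let f (v : V) : Fin 4 := if h : v ∉ I then g (φ ⟨v, h⟩) else 0
  have hfI {v : V} (hv : v ∈ I) : f v = 0 := dif_neg (not_not_intro hv)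
  have hfout {v : V} (hv : v ∉ I) : f v = g (φ ⟨v, hv⟩) := dif_pos hv
  refine nonempty_iso_completeMultipartiteGraph _ f (fun x y => ?_) fun i => ?_
  · by_cases hx : x ∈ I <;> by_cases hy : y ∈ I
    · simp only [hfI hx, hfI hy, hind x hx y hy, ne_eq, not_true_eq_false]
    · simp only [hfI hx, hfout hy, hjoin x hx y hy, (hg0 _).symm, ne_eq, not_false_eq_true]
    · simp only [hfout hx, hfI hy, (hjoin y hy x hx).symm, hg0, ne_eq, not_false_eq_true]
    · rw [hfout hx, hfout hy, hg, φ.map_adj_iff, induce_adj]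
  · have hin : #{v ∈ I | f v = i} = if i = 0 then 6 else 0 := by
      rw [← hI, filter_congr fun v hv => by rw [hfI hv, eq_comm], filter_const]
      split_ifs <;> rfl
    have hout : #{v | v ∉ I ∧ f v = i} = #{s | g s = i} := by
      refine (card_bij (fun s _ => (φ.symm s : V)) (fun s hs => ?_)
        (fun s _ t _ h => φ.symm.injective (Subtype.ext h)) fun v hv => ?_).symm
      · have hs' : (φ.symm s : V) ∉ I := (φ.symm s).2
        rw [mem_filter, hfout hs', Subtype.coe_eta, φ.apply_symm_apply]
        exact ⟨mem_univ _, hs', (mem_filter.1 hs).2⟩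
      · obtain ⟨-, hvI, hvi⟩ := mem_filter.1 hv
        rw [hfout hvI] at hvi
        exact ⟨φ ⟨v, hvI⟩, mem_filter.2 ⟨mem_univ _, hvi⟩, by rw [φ.symm_apply_apply]⟩
    rw [← card_filter_add_card_filter_not (· ∈ I), filter_comm, filter_univ_mem, filter_comm,
      filter_filter, hin, hout]
    exact hg_card i

variable [Fintype V] [DecidableRel G.Adj]

theorem exists_forall_notMem_adj_of_cliqueFree_five {I : Finset V} (hG : G.CliqueFree 5)
    (hV : Fintype.card V = 11) (hI : #I = 6) (he : 38 ≤ #G.edgeFinset)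
    (hdeg : ∑ v ∈ I, G.degree v ≤ 30) :
    ∃ x ∈ I, ∀ w ∉ I, G.Adj x w := by
  classical
  by_contra! hmiss
  have hnotMem : #{w | w ∉ I} = 4 + 1 := by
    rw [filter_notMem_eq_sdiff, card_univ_sdiff, hV, hI]
  have hcross : ∑ v ∈ I, #{w | w ∉ I ∧ G.Adj v w} ≤ #I * 4 := by
    refine sum_le_card_nsmul I _ 4 fun v hv => Nat.le_of_lt_add_one ?_
    obtain ⟨w, hw, hvw⟩ := hmiss v hv
    rw [← filter_filter, ← hnotMem]
    exact card_lt_card (filter_ssubset.2 ⟨w, by simpa using hw, hvw⟩)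
  have hout := card_edgeFinset_le_turanGraph
    (hG.comap ⟨(Embedding.induce {v | v ∉ I}).toCopy⟩) ((card_notMem I).trans (by rw [hV, hI]))
  have h_turan : #(turanGraph (11 - 6) 4).edgeFinset = 9 := by decide
  have hsum := sum_degree_eq_two_mul_card_edgeFinset_induce_add (G := G) I
  have hedges := card_edgeFinset_eq_card_edgeFinset_induce_add (G := G) I
  omega

theorem nonempty_iso_K6221 (hG : G.CliqueFree 5) (hV : Fintype.card V = 11)
    (he : 38 ≤ #G.edgeFinset) (hlow : 6 ≤ #{v | G.degree v < 6}) : Nonempty (G ≃g K6221) := by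
  classical
  obtain ⟨I, hIlow, hI⟩ := exists_subset_card_eq hlow
  have hdeg : ∑ v ∈ I, G.degree v ≤ #I * 5 := sum_le_card_nsmul I _ 5 fun v hv =>
    Nat.le_of_lt_add_one (mem_filter.1 (hIlow hv)).2
  obtain ⟨x, -, hx⟩ := exists_forall_notMem_adj_of_cliqueFree_five hG hV hI he (by omega)
  have hcard : Fintype.card {v | v ∉ I} = 5 := by rw [card_notMem, hV, hI]
  have hout4 : (G.induce {v | v ∉ I}).CliqueFree 4 := cliqueFree_induce_of_forall_adj hG hx
  have hout := card_edgeFinset_le_turanGraph hout4 hcard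
  have h_turan : #(turanGraph 5 3).edgeFinset = 8 := by decide
  have hsum := sum_degree_eq_two_mul_card_edgeFinset_induce_add (G := G) I
  have hedges := card_edgeFinset_eq_card_edgeFinset_induce_add (G := G) I
  obtain ⟨φ⟩ := nonempty_iso_turanGraph_of_le_card_edgeFinset hout4 hcard (by omega)
  refine nonempty_iso_K6221_of_iso_turanGraph hI (fun x hx y hy hxy => ?_) (fun x hx y hy => ?_) φ
  · have hin : #(G.induce {v | v ∈ I}).edgeFinset = 0 := by omega
    rw [card_eq_zero, edgeFinset_eq_empty] at hin
    exact hin.le (show (G.induce {v | v ∈ I}).Adj ⟨x, hx⟩ ⟨y, hy⟩ from hxy)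
  · have hnotMem : #{w | w ∉ I} = 5 := by
      rw [filter_notMem_eq_sdiff, card_univ_sdiff, hV, hI]
    have hle (v : V) : #{w | w ∉ I ∧ G.Adj v w} ≤ 5 := by
      rw [← hnotMem, ← filter_filter]
      exact card_filter_le _ _
    have hsum_eq : ∑ v ∈ I, #{w | w ∉ I ∧ G.Adj v w} = ∑ v ∈ I, 5 := by
      rw [sum_const, smul_eq_mul]
      omega
    have hall := (sum_eq_sum_iff_of_le fun v _ => hle v).1 hsum_eq x hx
    rw [← hnotMem, ← filter_filter, card_filter_eq_iff] at hall
    exact hall y (mem_filter.2 ⟨mem_univ y, hy⟩)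

end K6221

section Main

variable {V : Type*} [Fintype V] {G : SimpleGraph V} [DecidableRel G.Adj] {r k : ℕ}

theorem card_edgeFinset_of_isTuranPlusVertex {n : ℕ} (h : G.IsTuranPlusVertex n r k) :
    #G.edgeFinset = #(turanGraph (n - 1) r).edgeFinset + (k + 1) := by
  classical
  obtain ⟨-, -, v, hv, ⟨φ⟩⟩ := h
  rw [card_edgeFinset_eq_card_edgeFinset_induce_ne_add_degree v, hv, φ.card_edgeFinset_eq]

theorem isTuranPlusVertex_of_degree_le (hG : G.CliqueFree (r + 1)) {v : V}
    (hv : G.degree v ≤ k + 1)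
    (he : #(turanGraph (Fintype.card V - 1) r).edgeFinset + (k + 1) ≤ #G.edgeFinset) :
    G.IsTuranPlusVertex (Fintype.card V) r k := by
  classical
  have hfree : (G.induce {w | w ≠ v}).CliqueFree (r + 1) :=
    hG.comap ⟨(Embedding.induce {w | w ≠ v}).toCopy⟩
  have hcard : Fintype.card {w | w ≠ v} = Fintype.card V - 1 := Set.card_ne_eq v
  have hle := card_edgeFinset_le_turanGraph hfree hcard
  rw [card_edgeFinset_eq_card_edgeFinset_induce_ne_add_degree v] at he
  exact ⟨rfl, hG, v, by omega,
    nonempty_iso_turanGraph_of_le_card_edgeFinset hfree hcard (by omega)⟩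

theorem card_edgeFinset_lt_or_le_of_degree_le (hr : 3 ≤ r) (hG : G.CliqueFree (r + 1))
    {A : Finset V}
    (hn : (if r = 3 then 6 * k + 26 else if r ≤ 7 then 6 * k + 11 else 2 * k + 9) ≤
      Fintype.card V)
    (hA : 2 ≤ #A) (hAV : 2 * #A + k < Fintype.card V) (hdeg : ∀ v ∈ A, G.degree v ≤ #A + k) :
    #G.edgeFinset < #(turanGraph (Fintype.card V - 1) r).edgeFinset + (k + 1) ∨
      #G.edgeFinset ≤ 38 ∧ k = 0 ∧ r = 4 ∧ Fintype.card V = 11 ∧ #A = 5 := by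
  have hle := card_edgeFinset_le_turanGraph_add_of_degree_le hG hdeg
  split_ifs at hn with h3 h7
  · subst h3
    exact .inl (card_edgeFinset_lt_of_cliqueFree_four hG hA hdeg hAV hn)
  · have h4 : 4 ≤ r := by omega
    obtain hlt | ⟨rfl, rfl, hV, hA⟩ := turanGraph_add_lt_or_of_four_le h4 hA hAV hn
    · exact .inl (hle.trans_lt hlt)
    · have h_turan : #(turanGraph (11 - 5) 4).edgeFinset = 13 := by decide
      rw [hV, hA, h_turan] at hle
      exact .inr ⟨hle, rfl, rfl, hV, hA⟩
  · exact .inl (hle.trans_lt (turanGraph_add_lt_of_eight_le (by omega) hA hAV hn))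

theorem card_edgeFinset_lt_or_eq_of_not_isHamiltonian_induce [DecidableEq V] (hr : 3 ≤ r)
    (hG : G.CliqueFree (r + 1)) {S : Finset V}
    (hn : (if r = 3 then 6 * #S + 26 else if r ≤ 7 then 6 * #S + 11 else 2 * #S + 9) ≤
      Fintype.card V)
    (hS : ¬ (G.induce {v | v ∉ S}).IsHamiltonian) :
    #G.edgeFinset < #(turanGraph (Fintype.card V - 1) r).edgeFinset + (#S + 1) ∨
      #G.edgeFinset = #(turanGraph (Fintype.card V - 1) r).edgeFinset + (#S + 1) ∧
        (G.IsTuranPlusVertex (Fintype.card V) r #S ∨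
          (Nonempty (G ≃g K6221) ∧ #S = 0 ∧ r = 4 ∧ Fintype.card V = 11)) := by
  have hcard : 3 ≤ Fintype.card {v | v ∉ S} := by
    rw [card_notMem]
    split_ifs at hn <;> omega
  obtain ⟨i, hi⟩ := exists_isChvatalObstruction_of_not_isHamiltonian hcard hS
  obtain ⟨A, hAdeg, rfl⟩ := exists_subset_card_eq hi.le_card_degree_le_add
  have hdeg (v) (hv : v ∈ A) : G.degree v ≤ #A + #S := (mem_filter.1 (hAdeg hv)).2
  have hAV := hi.two_mul_lt
  rw [card_notMem] at hAV
  refine or_iff_not_imp_left.2 fun hge => ?_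
  rw [not_lt] at hge
  obtain hA | hA : #A = 1 ∨ 2 ≤ #A := by have := hi.pos; omega
  · obtain ⟨v, rfl⟩ := card_eq_one.1 hA
    have hv := hdeg v (mem_singleton_self v)
    have h := isTuranPlusVertex_of_degree_le hG (by rwa [card_singleton, add_comm] at hv) hge
    exact ⟨card_edgeFinset_of_isTuranPlusVertex h, .inl h⟩
  · obtain hlt | ⟨he, hS, rfl, hV, hA⟩ :=
      card_edgeFinset_lt_or_le_of_degree_le hr hG hn hA (by omega) hdeg
    · exact absurd hlt hge.not_gt
    · have h_turan : #(turanGraph (11 - 1) 4).edgeFinset = 37 := by decide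
      rw [hS, hV, h_turan] at hge ⊢
      have hlow := hi.le_card_degree_lt_sub
      rw [hS, hV, hA] at hlow
      exact ⟨by omega, .inr ⟨nonempty_iso_K6221 hG hV hge hlow, rfl, rfl, rfl⟩⟩

end Main

theorem mainTheorem5 {V : Type*} [Fintype V] [DecidableEq V] (G : SimpleGraph V)
    [DecidableRel G.Adj] (n r k : ℕ) (hV : Fintype.card V = n) (hr : 3 ≤ r)
    (hn : (if r = 3 then 6 * k + 26 else if r ≤ 7 then 6 * k + 11 else 2 * k + 9) ≤ n)
    (hfree : G.CliqueFree (r + 1)) (hG : ¬ G.IsKHamiltonian k) :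
    G.edgeFinset.card ≤ (SimpleGraph.turanGraph (n - 1) r).edgeFinset.card + (k + 1) ∧
    (G.edgeFinset.card = (SimpleGraph.turanGraph (n - 1) r).edgeFinset.card + (k + 1) ↔
      G.IsTuranPlusVertex n r k ∨
        (Nonempty (G ≃g SimpleGraph.K6221) ∧ k = 0 ∧ r = 4 ∧ n = 11)) := by
  subst hV
  obtain ⟨S, hSk, hS⟩ : ∃ S : Finset V, #S ≤ k ∧ ¬ (G.induce {v | v ∉ S}).IsHamiltonian := by
    simpa only [IsKHamiltonian, not_forall, exists_prop] using hG
  have hbound := card_edgeFinset_lt_or_eq_of_not_isHamiltonian_induce hr hfree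
    (by split_ifs at hn ⊢ <;> omega) hS
  refine ⟨by omega, fun heq => ?_, ?_⟩
  · obtain ⟨-, hextremal⟩ := hbound.resolve_left (by omega)
    obtain rfl : #S = k := by omega
    exact hextremal
  · rintro (h | ⟨⟨φ⟩, rfl, rfl, hV⟩)
    · exact card_edgeFinset_of_isTuranPlusVertex h
    · rw [φ.card_edgeFinset_eq, card_edgeFinset_K6221, hV]
      decide
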